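/- **Classical variational principle.** Let $(X,d)$ be a compact metric space and $T:X\to X$ a continuous map. For $n\ge 1$ put $d_n(x,y)=\max_{0\le k<n}d(T^kx,T^ky)$. Call $E\subseteq X$ *$(n,\varepsilon)$-separated* if $d_n(x,y)>\varepsilon$ for all distinct $x,y\in E$, let $N_d(n,\varepsilon)$ be the maximal cardinality of an $(n,\varepsilon)$-separated subset of $X$, and define $$S(X,d,\varepsilon)=\limsup_{n\to\infty}\frac1n\log N_d(n,\varepsilon),\qquad h_{top}(X,T)=\lim_{\varepsilon\to0^+}S(X,d,\varepsilon)\in[-\infty,\infty].$$ Let $\mathcal M_T(X)$ be the set of Borel probability measures $\mu$ on $X$ with $\mu(T^{-1}A)=\mu(A)$ for every Borel set $A$. For $\mu\in\mathcal M_T(X)$ and a finite Borel partition $\mathcal P$ of $X$ put $$H_\mu(\mathcal P)=-\sum_{P\in\mathcal P}\mu(P)\log\mu(P),\quad \mathcal P^n=\mathcal P\vee T^{-1}\mathcal P\vee\dots\vee T^{-(n-1)}\mathcal P,\quad h_\mu(\mathcal P,T)=\inf_{n\ge1}\frac1nH_\mu(\mathcal P^n),$$ with $0\log 0=0$, and let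 $h_\mu(T)=\sup_{\mathcal P}h_\mu(\mathcal P,T)\in[0,\infty]$, the supremum being over all finite Borel partitions $\mathcal P$ of $X$. Then $$h_{top}(X,T)=\sup_{\mu\in\mathcal M_T(X)}h_\mu(T)$$ as an equality in $[-\infty,\infty]$. (Both sides lie in $[0,\infty]$ if $X\neq\emptyset$; for $X=\emptyset$ both are $-\infty$ by the conventions $\log 0=\sup\emptyset=-\infty$.) -/

import Mathlib

open Filter Topology MeasureTheory

namespace VarPrinciple

/-! ### Topological entropy through separated sets -/

section Topological

variable {X : Type*} [MetricSpace X]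

/-- The dynamical metric `d_n(x, y) = max_{0 ≤ k < n} d(T^k x, T^k y)` (equal to `0` for `n = 0`). -/
noncomputable def dynDist (T : X → X) (n : ℕ) (x y : X) : ℝ :=
  ((Finset.range n).sup fun k => nndist (T^[k] x) (T^[k] y) : NNReal)

/-- A set is `(n, ε)`-separated if its distinct points have `d_n`-distance larger than `ε`. -/
def IsDynSeparated (T : X → X) (n : ℕ) (ε : ℝ) (E : Set X) : Prop :=
  E.Pairwise fun x y => ε < dynDist T n x y

/-- `N_d(n, ε)`, the maximal cardinality of an `(n, ε)`-separated set. -/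
noncomputable def sepNumber (T : X → X) (n : ℕ) (ε : ℝ) : ℕ∞ :=
  ⨆ (E : Set X) (_ : IsDynSeparated T n ε E), E.encard

/-- `S(X, d, ε) = limsup_{n → ∞} (1 / n) log N_d(n, ε)`, as an extended real number. -/
noncomputable def sepGrowth (T : X → X) (ε : ℝ) : EReal :=
  limsup (fun n : ℕ => ENNReal.log (sepNumber T n ε : ENNReal) / (n : EReal)) atTop

/-- The topological entropy `h_top(X, T) = lim_{ε → 0⁺} S(X, d, ε)`, as an extended real number.
The limit always exists: see `tendsto_sepGrowth`. -/
noncomputable def topEntropy (T : X → X) : EReal :=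
  limUnder (𝓝[>] (0 : ℝ)) (sepGrowth T)

theorem sepGrowth_antitone (T : X → X) : Antitone (sepGrowth T) := by
  intro ε ε' h
  refine limsup_le_limsup (Eventually.of_forall fun n => ?_)
  refine EReal.div_le_div_right_of_nonneg (by positivity) (ENNReal.log_monotone ?_)
  refine ENat.toENNReal_mono (iSup₂_mono' fun E hE => ⟨E, fun x hx y hy hxy => ?_, le_rfl⟩)
  exact h.trans_lt (hE hx hy hxy)

theorem tendsto_sepGrowth_iSup (T : X → X) :
    Tendsto (sepGrowth T) (𝓝[>] 0) (𝓝 (⨆ ε > (0 : ℝ), sepGrowth T ε)) := by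
  have h := (sepGrowth_antitone T).tendsto_nhdsGT (0 : ℝ)
  rwa [sSup_image] at h

theorem topEntropy_eq_iSup (T : X → X) : topEntropy T = ⨆ ε > (0 : ℝ), sepGrowth T ε :=
  (tendsto_sepGrowth_iSup T).limUnder_eq

theorem tendsto_sepGrowth (T : X → X) :
    Tendsto (sepGrowth T) (𝓝[>] 0) (𝓝 (topEntropy T)) := by
  rw [topEntropy_eq_iSup]
  exact tendsto_sepGrowth_iSup T

end Topological

/-! ### Measure-theoretic entropy -/

section Measurable

variable {X : Type*} [MeasurableSpace X]

/-- The family `P` is a measurable partition of `X` (empty cells are allowed; they contribute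
nothing to any entropy). -/
structure IsPartition {ι : Type*} (P : ι → Set X) : Prop where
  measurableSet : ∀ i, MeasurableSet (P i)
  disjoint : Pairwise fun i j => Disjoint (P i) (P j)
  iUnion_eq : ⋃ i, P i = Set.univ

/-- `H_μ(P) = - ∑ i, μ(P i) log μ(P i)`, with `0 log 0 = 0`. -/
noncomputable def partEntropy {ι : Type*} [Fintype ι] (μ : Measure X) (P : ι → Set X) : ℝ :=
  -∑ i, μ.real (P i) * Real.log (μ.real (P i))

/-- The refinement `P^n = P ∨ T⁻¹ P ∨ ⋯ ∨ T^{-(n-1)} P`: its cells are the sets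
`P (w 0) ∩ T⁻¹ P (w 1) ∩ ⋯ ∩ T^{-(n-1)} P (w (n-1))`. -/
def refinement {ι : Type*} (T : X → X) (P : ι → Set X) (n : ℕ) : (Fin n → ι) → Set X :=
  fun w => ⋂ k : Fin n, T^[(k : ℕ)] ⁻¹' P (w k)

theorem IsPartition.refinement {ι : Type*} {T : X → X} (hT : Measurable T) {P : ι → Set X}
    (hP : IsPartition P) (n : ℕ) : IsPartition (refinement T P n) where
  measurableSet w := MeasurableSet.iInter fun k => (hT.iterate k) (hP.measurableSet (w k))
  disjoint v w hvw := by
    obtain ⟨k, hk⟩ := Function.ne_iff.mp hvw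
    exact ((hP.disjoint hk).preimage (T^[(k : ℕ)])).mono (Set.iInter_subset _ k)
      (Set.iInter_subset _ k)
  iUnion_eq := by
    refine Set.eq_univ_of_forall fun x => ?_
    have h : ∀ y, ∃ i, y ∈ P i := fun y => by
      simpa using (hP.iUnion_eq ▸ Set.mem_univ y : y ∈ ⋃ i, P i)
    choose f hf using h
    exact Set.mem_iUnion.2 ⟨fun k => f (T^[(k : ℕ)] x), Set.mem_iInter.2 fun k => hf _⟩

/-- `h_μ(P, T) = inf_{n ≥ 1} (1 / n) H_μ(P^n)`, as an extended real number. -/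
noncomputable def entropyOfPartition {ι : Type*} [Fintype ι] (μ : Measure X) (T : X → X)
    (P : ι → Set X) : EReal :=
  ⨅ (n : ℕ) (_ : 1 ≤ n), ((partEntropy μ (refinement T P n) / n : ℝ) : EReal)

/-- The entropy `h_μ(T) = sup_P h_μ(P, T)`, the supremum being over all finite measurable
partitions `P` of `X`. -/
noncomputable def measureEntropy (μ : Measure X) (T : X → X) : EReal :=
  ⨆ (m : ℕ) (P : Fin m → Set X) (_ : IsPartition P), entropyOfPartition μ T P

/-- The set `M_T(X)` of `T`-invariant probability measures on `X`. -/
def invariantMeasures (T : X → X) : Set (ProbabilityMeasure X) :=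
  {μ | ∀ A : Set X, MeasurableSet A → (μ : Measure X) A = (μ : Measure X) (T ⁻¹' A)}

end Measurable

end VarPrinciple

namespace VarPrinciple

/-! ### Entropy of finite partitions -/

/-! Both inequalities compare the entropy of `P^n` with the size of a maximal separated set.

Measure entropy is at most topological entropy by coding
(`IsPartition.partEntropy_refinement_le_log_card`). Shrink the cells to disjoint compact sets `K i`.
A point of a spanning set `E` predicts the itinerary of any point it shadows, except at times spent
outside `⋃ i, K i`. Mixing over `E` the product laws concentrated on the predicted itineraries gives
a law on words; Gibbs' inequality against it, with invariance, bounds the entropy by `log |E|` plus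
a small multiple of `n`.

The converse is Misiurewicz's argument. The uniform measure on a separated set has entropy `log |E|`
for a fine partition refined `n` times. Tiling by blocks of length `q`
(`IsPartition.mul_partEntropy_refinement_le`) and concavity (`sum_partEntropy_map_le`) transfer this
to the orbit average. A limit of orbit averages is invariant, and a partition with null boundaries
lets entropy pass to the limit (`coe_le_entropyOfPartition_of_tendsto`). -/

/-- **Gibbs' inequality.** -/
theorem sum_mul_log_le_sum_mul_log {ι : Type*} [Fintype ι] {p r : ι → ℝ} (hp : ∀ i, 0 ≤ p i)
    (hr : ∀ i, 0 ≤ r i) (hpr : ∀ i, r i = 0 → p i = 0) (h : ∑ i, r i ≤ ∑ i, p i) :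
    ∑ i, p i * Real.log (r i) ≤ ∑ i, p i * Real.log (p i) := by
  have key : ∀ i, p i * Real.log (r i) - p i * Real.log (p i) ≤ r i - p i := by
    intro i
    rcases (hp i).eq_or_lt with h0 | h0
    · simpa [← h0] using hr i
    · have hri : 0 < r i := (hr i).lt_of_ne fun h1 => h0.ne' (hpr i h1.symm)
      rw [← mul_sub, ← Real.log_div hri.ne' h0.ne']
      calc p i * Real.log (r i / p i) ≤ p i * (r i / p i - 1) :=
            mul_le_mul_of_nonneg_left (Real.log_le_sub_one_of_pos (by positivity)) h0.le
        _ = r i - p i := by field_simp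
  have := Finset.sum_le_sum fun i (_ : i ∈ Finset.univ) => key i
  rw [Finset.sum_sub_distrib, Finset.sum_sub_distrib] at this
  linarith

section Refinement

variable {X ι : Type*} {T : X → X} {P : ι → Set X}

theorem mem_refinement {n : ℕ} {w : Fin n → ι} {x : X} :
    x ∈ refinement T P n w ↔ ∀ k : Fin n, T^[k] x ∈ P (w k) := by
  simp [refinement]

theorem refinement_append {a b : ℕ} (u : Fin a → ι) (v : Fin b → ι) :
    refinement T P (a + b) (Fin.append u v) =
      refinement T P a u ∩ T^[a] ⁻¹' refinement T P b v := by
  ext x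
  simp only [mem_refinement, Set.mem_inter_iff, Set.mem_preimage]
  constructor
  · refine fun h => ⟨fun k => by simpa using h (Fin.castAdd b k), fun k => ?_⟩
    have := h (Fin.natAdd a k)
    rw [Fin.append_right] at this
    rwa [← Function.iterate_add_apply, add_comm]
  · rintro ⟨h1, h2⟩ k
    refine Fin.addCases (fun i => ?_) (fun i => ?_) k
    · simpa using h1 i
    · have := h2 i
      rw [← Function.iterate_add_apply, add_comm] at this
      simpa using this

end Refinement

section Partition

variable {X : Type*} [MeasurableSpace X] {ι : Type*} {T : X → X} {P : ι → Set X}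

theorem IsPartition.exists_mem (hP : IsPartition P) (x : X) : ∃ i, x ∈ P i := by
  simpa using (hP.iUnion_eq ▸ Set.mem_univ x : x ∈ ⋃ i, P i)

theorem IsPartition.eq_of_mem (hP : IsPartition P) {x : X} {i j : ι} (hi : x ∈ P i)
    (hj : x ∈ P j) : i = j := by
  by_contra h
  exact Set.disjoint_left.1 (hP.disjoint h) hi hj

theorem IsPartition.sum_measureReal_inter [Fintype ι] (hP : IsPartition P) (μ : Measure X)
    [IsFiniteMeasure μ] {A : Set X} (hA : MeasurableSet A) :
    ∑ i, μ.real (A ∩ P i) = μ.real A := by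
  rw [← measureReal_iUnion_fintype _ fun i => hA.inter (hP.measurableSet i), ← Set.inter_iUnion,
    hP.iUnion_eq, Set.inter_univ]
  exact fun i j h => (hP.disjoint h).mono Set.inter_subset_right Set.inter_subset_right

theorem IsPartition.sum_measureReal [Fintype ι] (hP : IsPartition P) (μ : Measure X)
    [IsProbabilityMeasure μ] : ∑ i, μ.real (P i) = 1 := by
  simpa using hP.sum_measureReal_inter μ MeasurableSet.univ

theorem partEntropy_eq_sum_negMulLog [Fintype ι] (μ : Measure X) (P : ι → Set X) :
    partEntropy μ P = ∑ i, Real.negMulLog (μ.real (P i)) := by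
  simp [partEntropy, Real.negMulLog, Finset.sum_neg_distrib]

theorem partEntropy_nonneg [Fintype ι] (μ : Measure X) [IsProbabilityMeasure μ]
    (P : ι → Set X) : 0 ≤ partEntropy μ P := by
  rw [partEntropy_eq_sum_negMulLog]
  exact Finset.sum_nonneg fun i _ => Real.negMulLog_nonneg measureReal_nonneg measureReal_le_one

/-- The form in which Gibbs' inequality is used: every trial weight `r` yields an upper bound. -/
theorem IsPartition.partEntropy_le [Fintype ι] (hP : IsPartition P) (μ : Measure X)
    [IsProbabilityMeasure μ] {r : ι → ℝ} (hr : ∀ i, 0 ≤ r i)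
    (hpr : ∀ i, r i = 0 → μ.real (P i) = 0) (h : ∑ i, r i ≤ 1) :
    partEntropy μ P ≤ -∑ i, μ.real (P i) * Real.log (r i) :=
  neg_le_neg <| sum_mul_log_le_sum_mul_log (fun _ => measureReal_nonneg) hr hpr <| by
    rwa [hP.sum_measureReal μ]

theorem IsPartition.partEntropy_le_log_card [Fintype ι] (hP : IsPartition P) (μ : Measure X)
    [IsProbabilityMeasure μ] : partEntropy μ P ≤ Real.log (Fintype.card ι) := by
  obtain ⟨x⟩ := nonempty_of_isProbabilityMeasure μ
  have : Nonempty ι := ⟨(hP.exists_mem x).choose⟩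
  have hc : (0 : ℝ) < Fintype.card ι := by exact_mod_cast Fintype.card_pos
  refine (hP.partEntropy_le μ (r := fun _ => (Fintype.card ι : ℝ)⁻¹) (fun _ => by positivity)
    (fun _ h => absurd h (by positivity)) (by simp [hc.ne'])).trans ?_
  rw [← Finset.sum_mul, hP.sum_measureReal μ, Real.log_inv]
  simp

/-- Subadditivity of the entropy of refinements. -/
theorem IsPartition.partEntropy_refinement_add_le [Fintype ι] (hP : IsPartition P)
    (hT : Measurable T) (μ : Measure X) [IsProbabilityMeasure μ] (a b : ℕ) :
    partEntropy μ (VarPrinciple.refinement T P (a + b)) ≤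
      partEntropy μ (VarPrinciple.refinement T P a) +
        partEntropy (μ.map T^[a]) (VarPrinciple.refinement T P b) := by
  have hA := hP.refinement hT a
  have hB := hP.refinement hT b
  have hTa := hT.iterate a
  have : IsProbabilityMeasure (μ.map T^[a]) := Measure.isProbabilityMeasure_map hTa.aemeasurable
  have hB' : IsPartition fun v => T^[a] ⁻¹' VarPrinciple.refinement T P b v :=
    ⟨fun v => hTa (hB.measurableSet v), fun _ _ h => (hB.disjoint h).preimage _, by
      rw [← Set.preimage_iUnion, hB.iUnion_eq, Set.preimage_univ]⟩
  have hmap : ∀ v, (μ.map T^[a]).real (VarPrinciple.refinement T P b v) =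
      μ.real (T^[a] ⁻¹' VarPrinciple.refinement T P b v) :=
    fun v => map_measureReal_apply hTa (hB.measurableSet v)
  simp only [partEntropy, hmap]
  set A := VarPrinciple.refinement T P a
  set B := fun v => T^[a] ⁻¹' VarPrinciple.refinement T P b v
  have e : ∀ f : (Fin (a + b) → ι) → ℝ, ∑ w, f w = ∑ z : (Fin a → ι) × (Fin b → ι),
      f (Fin.append z.1 z.2) := fun f => (Equiv.sum_comp (Fin.appendEquiv a b) f).symm
  rw [e]
  simp only [refinement_append]
  -- Gibbs for the joint law of the two blocks against the product of its marginals.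
  have g := sum_mul_log_le_sum_mul_log
    (p := fun z : (Fin a → ι) × (Fin b → ι) => μ.real (A z.1 ∩ B z.2))
    (r := fun z => μ.real (A z.1) * μ.real (B z.2)) (fun _ => measureReal_nonneg)
    (fun _ => by positivity) (fun z h => ?_) ?_
  · have h1 : ∑ z : (Fin a → ι) × (Fin b → ι),
        μ.real (A z.1 ∩ B z.2) * Real.log (μ.real (A z.1) * μ.real (B z.2)) =
        ∑ u, μ.real (A u) * Real.log (μ.real (A u)) +
          ∑ v, μ.real (B v) * Real.log (μ.real (B v)) := by
      have : ∀ z : (Fin a → ι) × (Fin b → ι),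
          μ.real (A z.1 ∩ B z.2) * Real.log (μ.real (A z.1) * μ.real (B z.2)) =
          μ.real (A z.1 ∩ B z.2) * Real.log (μ.real (A z.1)) +
            μ.real (B z.2 ∩ A z.1) * Real.log (μ.real (B z.2)) := by
        intro z
        rcases eq_or_ne (μ.real (A z.1)) 0 with h | h
        · have := measureReal_mono_null (Set.inter_subset_left (s := A z.1) (t := B z.2)) h
          rw [Set.inter_comm (B z.2), this]; ring
        rcases eq_or_ne (μ.real (B z.2)) 0 with h' | h'
        · have := measureReal_mono_null (Set.inter_subset_right (s := A z.1) (t := B z.2)) h'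
          rw [Set.inter_comm (B z.2), this]; ring
        rw [Real.log_mul h h', Set.inter_comm (B z.2)]; ring
      simp only [this, Finset.sum_add_distrib]
      congr 1
      · rw [Fintype.sum_prod_type]
        refine Finset.sum_congr rfl fun u _ => ?_
        dsimp only
        rw [← Finset.sum_mul, hB'.sum_measureReal_inter μ (hA.measurableSet u)]
      · rw [Fintype.sum_prod_type_right]
        refine Finset.sum_congr rfl fun v _ => ?_
        dsimp only
        rw [← Finset.sum_mul, hA.sum_measureReal_inter μ (hB'.measurableSet v)]
    simp only [B] at g h1 ⊢
    linarith
  · rcases mul_eq_zero.1 h with h | h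
    · exact measureReal_mono_null Set.inter_subset_left h
    · exact measureReal_mono_null Set.inter_subset_right h
  · rw [Fintype.sum_prod_type, Fintype.sum_prod_type]
    simp only [← Finset.mul_sum, hB'.sum_measureReal, mul_one]
    exact (Finset.sum_congr rfl fun u _ =>
      (hB'.sum_measureReal_inter μ (hA.measurableSet u)).symm).le

end Partition

/-! ### Separated sets -/

section Separated

variable {X : Type*} [MetricSpace X] {T : X → X}

theorem dynDist_le_iff {n : ℕ} {ε : ℝ} (hε : 0 ≤ ε) {x y : X} :
    dynDist T n x y ≤ ε ↔ ∀ k < n, dist (T^[k] x) (T^[k] y) ≤ ε := by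
  lift ε to NNReal using hε
  simp only [dynDist, NNReal.coe_le_coe, Finset.sup_le_iff, Finset.mem_range, ← coe_nndist]

theorem dynDist_comm (n : ℕ) (x y : X) : dynDist T n x y = dynDist T n y x := by
  simp only [dynDist, nndist_comm]

/-- Orbit segments form a compact set in `Fin n → X`; each ball of a finite `ε / 2`-cover contains
at most one segment starting in a separated set. -/
theorem sepNumber_lt_top [CompactSpace X] (hT : Continuous T) (n : ℕ) {ε : ℝ} (hε : 0 < ε) :
    sepNumber T n ε < ⊤ := by
  let F : X → Fin n → X := fun x k => T^[k] x
  have hF : Continuous F := continuous_pi fun k => hT.iterate k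
  obtain ⟨t, ht, hFt⟩ := Metric.totallyBounded_iff.1 (isCompact_range hF).totallyBounded (ε / 2)
    (half_pos hε)
  have hc : ∀ x, ∃ y ∈ t, dist (F x) y < ε / 2 := fun x => by
    simpa using hFt (Set.mem_range_self x)
  choose g hgt hg using hc
  refine lt_of_le_of_lt (iSup₂_le fun E hE => ?_) ht.encard_lt_top
  refine Set.encard_le_encard_of_injOn (f := g) (fun x _ => hgt x) fun x hx y hy hxy => ?_
  by_contra hne
  refine (hE hx hy hne).not_ge ((dynDist_le_iff hε.le).2 fun k hk => ?_)
  calc dist (T^[k] x) (T^[k] y) ≤ dist (F x) (F y) := dist_le_pi_dist (F x) (F y) ⟨k, hk⟩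
    _ ≤ dist (F x) (g x) + dist (F y) (g x) := dist_triangle_right _ _ _
    _ ≤ ε := by have := hg y; rw [← hxy] at this; linarith [hg x]

/-- A separated set of maximal cardinality exists and is spanning. -/
theorem exists_maximal_isDynSeparated [CompactSpace X] (hT : Continuous T) (n : ℕ) {ε : ℝ}
    (hε : 0 < ε) : ∃ E : Finset X, IsDynSeparated T n ε E ∧ sepNumber T n ε = E.card ∧
      ∀ y, ∃ x ∈ E, ∀ k < n, dist (T^[k] x) (T^[k] y) ≤ ε := by
  have hlt := sepNumber_lt_top hT n hε
  have hs : sepNumber T n ε = ⨆ E : {E : Set X // IsDynSeparated T n ε E}, E.1.encard := by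
    rw [sepNumber, iSup_subtype']
  have : Nonempty {E : Set X // IsDynSeparated T n ε E} := ⟨∅, Set.pairwise_empty _⟩
  obtain ⟨⟨E, hE⟩, hEc⟩ := ENat.exists_eq_iSup_of_lt_top (hs ▸ hlt)
  rw [← hs] at hEc
  simp only at hEc
  have hfin : E.Finite := Set.encard_lt_top_iff.1 (hEc ▸ hlt)
  lift E to Finset X using hfin
  refine ⟨E, hE, by simp [← hEc], fun y => ?_⟩
  -- An unshadowed `y` could be added to `E`, contradicting maximality.
  by_contra! hy
  have hyE : y ∉ E := fun h => by
    obtain ⟨k, _, hk⟩ := hy y h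
    simp only [dist_self] at hk
    linarith
  have hsep : ∀ x ∈ E, ε < dynDist T n y x := fun x hx => by
    obtain ⟨k, hk, hd⟩ := hy x hx
    rw [dynDist_comm]
    by_contra! hle
    exact ((dynDist_le_iff hε.le).1 hle k hk).not_gt hd
  have hins : IsDynSeparated T n ε (insert y (E : Set X)) :=
    Set.Pairwise.insert hE fun x hx _ => ⟨hsep x hx, by rw [dynDist_comm]; exact hsep x hx⟩
  have hle : (insert y (E : Set X)).encard ≤ sepNumber T n ε :=
    le_iSup₂ (f := fun (E : Set X) (_ : IsDynSeparated T n ε E) => E.encard) _ hins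
  rw [← hEc, Set.encard_insert_of_notMem (by simpa using hyE)] at hle
  simp only [Set.encard_coe_eq_coe_finsetCard] at hle
  have : E.card + 1 ≤ E.card := by exact_mod_cast hle
  omega

theorem log_sepNumber_div {n : ℕ} {ε : ℝ} {N : ℕ} (hN : 0 < N) (h : sepNumber T n ε = N) :
    ENNReal.log (sepNumber T n ε : ENNReal) / (n : EReal) = ((Real.log N / n : ℝ) : EReal) := by
  rw [h, ENat.toENNReal_coe, ENNReal.log_pos_real (by simpa using hN.ne') (by simp)]
  simp [EReal.coe_div]

end Separated

/-! ### Measure entropy is bounded by topological entropy -/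

theorem measurePreserving_of_mem_invariantMeasures {X : Type*} [MeasurableSpace X] {T : X → X}
    (hT : Measurable T) {μ : ProbabilityMeasure X} (hμ : μ ∈ invariantMeasures T) :
    MeasurePreserving T (μ : Measure X) μ :=
  ⟨hT, Measure.ext fun A hA => by rw [Measure.map_apply hT hA]; exact (hμ A hA).symm⟩

section Weights

variable {ι : Type*} [Fintype ι] [DecidableEq ι]

/-- The probability vector on `ι` that puts mass `1 - η` on `a` and spreads `η` uniformly. -/
noncomputable def spread (η : ℝ) (a i : ι) : ℝ :=
  (if a = i then 1 - η else 0) + η / Fintype.card ι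

theorem sum_spread [Nonempty ι] (η : ℝ) (a : ι) : ∑ i, spread η a i = 1 := by
  have : (Fintype.card ι : ℝ) ≠ 0 := by exact_mod_cast Fintype.card_ne_zero
  simp [spread, Finset.sum_add_distrib, mul_div_cancel₀ _ this]

theorem sum_prod_spread [Nonempty ι] (η : ℝ) {n : ℕ} (a : Fin n → ι) :
    ∑ w : Fin n → ι, ∏ k, spread η (a k) (w k) = 1 := by
  rw [← Fintype.piFinset_univ, ← Finset.prod_univ_sum]
  simp [sum_spread]

end Weights

section UpperBound

variable {X : Type*} [MetricSpace X] [MeasurableSpace X] {T : X → X}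
  {ι : Type*} [Fintype ι] {P : ι → Set X}

/-- The factor `1 - η` is the price of a correct prediction, `η / card ι` that of a wrong one; the
latter is needed only on visits outside `⋃ i, K i`. -/
theorem IsPartition.partEntropy_refinement_le_log_card [Nonempty ι] (hP : IsPartition P)
    (hT : Measurable T) {μ : Measure X} [IsProbabilityMeasure μ] (hμ : MeasurePreserving T μ μ)
    {K : ι → Set X} (hK : ∀ i, MeasurableSet (K i)) (hKP : ∀ i, K i ⊆ P i) {δ η : ℝ}
    (hδ : ∀ i j, i ≠ j → ∀ x ∈ K i, ∀ y ∈ K j, 2 * δ < dist x y) (hη0 : 0 < η) (hη1 : η < 1)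
    {n : ℕ} {E : Finset X} (hE : ∀ y, ∃ x ∈ E, ∀ k < n, dist (T^[k] x) (T^[k] y) ≤ δ) :
    partEntropy μ (VarPrinciple.refinement T P n) ≤ Real.log E.card +
      n * (-Real.log (1 - η) + μ.real (⋃ i, K i)ᶜ * Real.log (Fintype.card ι / η)) := by
  classical
  -- The prediction is unambiguous: distinct `K i` are more than `2 * δ` apart.
  have hf : ∃ f : X → ι, ∀ x i, ∀ z ∈ K i, dist x z ≤ δ → f x = i := by
    refine ⟨fun x => if h : ∃ i, ∃ z ∈ K i, dist x z ≤ δ then h.choose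
      else Classical.arbitrary ι, fun x i z hz hxz => ?_⟩
    have h : ∃ i, ∃ z ∈ K i, dist x z ≤ δ := ⟨i, z, hz, hxz⟩
    simp only [dif_pos h]
    obtain ⟨z', hz', hxz'⟩ := h.choose_spec
    by_contra hne
    have := hδ _ _ hne z' hz' z hz
    linarith [dist_triangle_left z' z x]
  obtain ⟨f, hf⟩ := hf
  have hc : (0 : ℝ) < Fintype.card ι := by exact_mod_cast Fintype.card_pos
  have hc1 : (1 : ℝ) ≤ Fintype.card ι := by exact_mod_cast Fintype.card_pos (α := ι)
  set c : ℝ := (Fintype.card ι : ℝ)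
  set U := ⋃ i, K i
  have hU : MeasurableSet U := MeasurableSet.iUnion hK
  have hη' : 0 < 1 - η := by linarith
  -- Coding cost of one symbol; charging `-log (1 - η)` outside `U` as well only weakens the bound.
  let φ : X → ℝ := fun z => -Real.log (1 - η) + Uᶜ.indicator (fun _ => Real.log (c / η)) z
  have hφm : Measurable φ := measurable_const.add (measurable_const.indicator hU.compl)
  have hφi : Integrable φ μ :=
    (integrable_const _).add ((integrable_const _).indicator hU.compl)
  have hφ : ∫ z, φ z ∂μ = -Real.log (1 - η) + μ.real Uᶜ * Real.log (c / η) := by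
    rw [integral_add (integrable_const _) ((integrable_const _).indicator hU.compl),
      integral_indicator_const _ hU.compl]
    simp
  have hspread : ∀ (a i : ι), 0 < spread η a i := fun a i => by
    have : 0 < η / c := by positivity
    simp only [spread]; split_ifs <;> linarith
  have hq : ∀ x z i, z ∈ P i → dist x z ≤ δ → Real.exp (-φ z) ≤ spread η (f x) i := by
    intro x z i hz hxz
    have hηc : 0 < η / c := by positivity
    by_cases hzU : z ∈ U
    · obtain ⟨j, hj⟩ := Set.mem_iUnion.1 hzU
      have hji : j = i := hP.eq_of_mem (hKP j hj) hz
      subst hji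
      have : φ z = -Real.log (1 - η) := by simp [φ, hzU]
      rw [this, neg_neg, Real.exp_log hη', spread, if_pos (hf x _ z hj hxz)]
      linarith
    · have : -φ z = Real.log ((1 - η) * (η / c)) := by
        rw [Real.log_mul hη'.ne' hηc.ne', ← inv_div c η, Real.log_inv]
        simp [φ, hzU]
        ring
      rw [this, Real.exp_log (by positivity), spread]
      have h1 : (1 - η) * (η / c) ≤ η / c := mul_le_of_le_one_left hηc.le (by linarith)
      split_ifs <;> linarith
  obtain ⟨x₀⟩ := nonempty_of_isProbabilityMeasure μ
  have hN : 0 < E.card := Finset.card_pos.2 ⟨_, (hE x₀).choose_spec.1⟩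
  have hN' : (0 : ℝ) < E.card := by exact_mod_cast hN
  -- Trial law: choose `x ∈ E` uniformly, then perturb each predicted symbol independently.
  let r : (Fin n → ι) → ℝ := fun w =>
    (E.card : ℝ)⁻¹ * ∑ x ∈ E, ∏ k : Fin n, spread η (f (T^[k] x)) (w k)
  have hr : ∀ w, 0 < r w := fun w => mul_pos (inv_pos.2 hN') <|
    Finset.sum_pos (fun x _ => Finset.prod_pos fun k _ => hspread _ _) (Finset.card_pos.1 hN)
  have hrsum : ∑ w, r w = 1 := by
    simp only [r]
    rw [← Finset.mul_sum, Finset.sum_comm]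
    simp [sum_prod_spread, hN'.ne']
  let Φ : X → ℝ := fun y => Real.log E.card + ∑ k : Fin n, φ (T^[k] y)
  have hpt : ∀ w, ∀ y ∈ VarPrinciple.refinement T P n w, -Real.log (r w) ≤ Φ y := by
    intro w y hy
    rw [mem_refinement] at hy
    obtain ⟨x, hxE, hx⟩ := hE y
    have h1 : (E.card : ℝ)⁻¹ * Real.exp (-∑ k : Fin n, φ (T^[k] y)) ≤ r w := by
      refine mul_le_mul_of_nonneg_left ?_ (by positivity)
      refine le_trans ?_ (Finset.single_le_sum (fun x _ => (Finset.prod_pos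
        fun (k : Fin n) _ => hspread (f (T^[k] x)) (w k)).le) hxE)
      rw [← Finset.sum_neg_distrib, Real.exp_sum]
      exact Finset.prod_le_prod (fun _ _ => (Real.exp_pos _).le)
        fun k _ => hq _ _ _ (hy k) (hx k k.2)
    have h2 := Real.log_le_log (by positivity) h1
    rw [Real.log_mul (by positivity) (Real.exp_pos _).ne', Real.log_exp, Real.log_inv] at h2
    simp only [Φ]
    linarith
  have hint : ∀ k : ℕ, Integrable (fun y => φ (T^[k] y)) μ := fun k =>
    (hμ.iterate k).integrable_comp_of_integrable hφi
  have hΦi : Integrable Φ μ := (integrable_const _).add (integrable_finsetSum _ fun k _ => hint k)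
  have hΦ : ∫ y, Φ y ∂μ = Real.log E.card + n * ∫ z, φ z ∂μ := by
    rw [integral_add (integrable_const _) (integrable_finsetSum _ fun (k : Fin n) _ => hint k),
      integral_finsetSum _ fun (k : Fin n) _ => hint k]
    have : ∀ k : ℕ, ∫ y, φ (T^[k] y) ∂μ = ∫ z, φ z ∂μ := fun k => by
      conv_rhs => rw [← (hμ.iterate k).map_eq]
      exact (integral_map (hμ.iterate k).measurable.aemeasurable
        hφm.aestronglyMeasurable).symm
    simp [this]
  have hR := hP.refinement hT n
  rw [← hφ, ← hΦ]
  refine (hR.partEntropy_le μ (fun w => (hr w).le) (fun w h => absurd h (hr w).ne')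
    hrsum.le).trans ?_
  -- Split the integral of `Φ` over the cells, on each of which `hpt` applies.
  rw [← setIntegral_univ, ← hR.iUnion_eq, integral_iUnion_fintype hR.measurableSet hR.disjoint
    fun _ => hΦi.integrableOn, ← Finset.sum_neg_distrib]
  refine Finset.sum_le_sum fun w _ => ?_
  calc -(μ.real (VarPrinciple.refinement T P n w) * Real.log (r w))
      = ∫ _ in VarPrinciple.refinement T P n w, -Real.log (r w) ∂μ := by simp
    _ ≤ _ := setIntegral_mono_on (integrable_const _).integrableOn hΦi.integrableOn
        (hR.measurableSet w) (hpt w)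

theorem IsPartition.entropyOfPartition_le_topEntropy [CompactSpace X] [BorelSpace X] (hP : IsPartition P)
    (hT : Continuous T) {μ : Measure X} [IsProbabilityMeasure μ] (hμ : MeasurePreserving T μ μ) :
    entropyOfPartition μ T P ≤ topEntropy T := by
  obtain ⟨x₀⟩ := nonempty_of_isProbabilityMeasure μ
  have : Nonempty ι := ⟨(hP.exists_mem x₀).choose⟩
  have hc : (0 : ℝ) < Fintype.card ι := by exact_mod_cast Fintype.card_pos
  have hc1 : (1 : ℝ) ≤ Fintype.card ι := by exact_mod_cast Fintype.card_pos (α := ι)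
  refine EReal.le_of_forall_lt_iff_le.1 fun z hz => ?_
  obtain ⟨z', hz', hzz⟩ := EReal.lt_iff_exists_real_btwn.1 hz
  have hzz : z' < z := by exact_mod_cast hzz
  obtain ⟨γ, hγ⟩ : ∃ γ, γ = (z - z') / 2 := ⟨_, rfl⟩
  have hγ0 : 0 < γ := by rw [hγ]; linarith
  -- Makes `-log (1 - η) = γ`; `θ` below makes the misprediction cost at most `γ`, so the total
  -- error per step is `2 * γ = z - z'`.
  obtain ⟨η, hη⟩ : ∃ η, η = 1 - Real.exp (-γ) := ⟨_, rfl⟩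
  have hη0 : 0 < η := by
    have : Real.exp (-γ) < 1 := by
      simpa using Real.exp_lt_exp.2 (neg_lt_zero.2 hγ0)
    linarith
  have hη1 : η < 1 := by have := Real.exp_pos (-γ); linarith
  have hlog : 0 < Real.log (Fintype.card ι / η) := by
    refine Real.log_pos ?_
    rw [lt_div_iff₀ hη0]; linarith
  obtain ⟨θ, hθ⟩ : ∃ θ, θ = γ / (Fintype.card ι * Real.log (Fintype.card ι / η)) := ⟨_, rfl⟩
  have hθ0 : 0 < θ := by rw [hθ]; positivity
  have hK : ∀ i, ∃ K ⊆ P i, IsCompact K ∧ μ (P i \ K) < ENNReal.ofReal θ := fun i =>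
    (hP.measurableSet i).exists_isCompact_sdiff_lt (measure_ne_top _ _) (by simpa using hθ0)
  choose K hKP hKc hKμ using hK
  have hU : μ.real (⋃ i, K i)ᶜ ≤ Fintype.card ι * θ := by
    have hsub : (⋃ i, K i)ᶜ ⊆ ⋃ i, P i \ K i := fun x hx => by
      obtain ⟨i, hi⟩ := hP.exists_mem x
      exact Set.mem_iUnion.2 ⟨i, hi, fun h => hx (Set.mem_iUnion.2 ⟨i, h⟩)⟩
    calc μ.real (⋃ i, K i)ᶜ ≤ μ.real (⋃ i, P i \ K i) := measureReal_mono hsub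
      _ ≤ ∑ i, μ.real (P i \ K i) := measureReal_iUnion_fintype_le _
      _ ≤ ∑ _i : ι, θ := Finset.sum_le_sum fun i _ =>
          ENNReal.toReal_le_of_le_ofReal hθ0.le (hKμ i).le
      _ = _ := by simp
  have hδ : ∃ δ : ℝ, 0 < δ ∧ ∀ i j, i ≠ j → ∀ x ∈ K i, ∀ y ∈ K j, 2 * δ < dist x y := by
    have hev : ∀ i j, ∀ᶠ δ : ℝ in 𝓝[>] 0, i ≠ j → ∀ x ∈ K i, ∀ y ∈ K j, 2 * δ < dist x y := by
      intro i j
      rcases eq_or_ne i j with h | h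
      · exact Eventually.of_forall fun _ h' => absurd h h'
      obtain ⟨s, hs0, hs⟩ := Metric.exists_pos_forall_lt_edist (hKc i) (hKc j).isClosed
        ((hP.disjoint h).mono (hKP i) (hKP j))
      filter_upwards [Ioo_mem_nhdsGT (show (0 : ℝ) < s / 2 by positivity)] with δ hδ _ x hx y hy
      have := hs x hx y hy
      rw [edist_nndist, ENNReal.coe_lt_coe] at this
      have : (s : ℝ) < dist x y := by rw [← coe_nndist]; exact_mod_cast this
      linarith [hδ.2]
    have := (eventually_all.2 fun i => eventually_all.2 (hev i)).and self_mem_nhdsWithin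
    obtain ⟨δ, h1, h2⟩ := this.exists
    exact ⟨δ, h2, h1⟩
  obtain ⟨δ, hδ0, hδ⟩ := hδ
  have hlim : sepGrowth T δ < (z' : EReal) := by
    refine lt_of_le_of_lt ?_ hz'
    rw [topEntropy_eq_iSup]
    exact le_iSup₂ (f := fun (ε : ℝ) (_ : ε > 0) => sepGrowth T ε) δ hδ0
  -- One good `n` suffices, since the partition entropy is an infimum over `n`.
  obtain ⟨n, hn, hn1⟩ := ((eventually_lt_of_limsup_lt hlim).and (eventually_ge_atTop 1)).exists
  obtain ⟨E, -, hEc, hE⟩ := exists_maximal_isDynSeparated hT n hδ0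
  have hN : 0 < E.card := Finset.card_pos.2 ⟨_, (hE x₀).choose_spec.1⟩
  rw [log_sepNumber_div hN hEc, EReal.coe_lt_coe_iff] at hn
  have hn0 : (0 : ℝ) < n := by exact_mod_cast hn1
  have hmain := hP.partEntropy_refinement_le_log_card hT.measurable hμ
    (fun i => (hKc i).measurableSet) hKP hδ hη0 hη1 hE
  have h1 : -Real.log (1 - η) = γ := by rw [hη]; simp
  have h2 : μ.real (⋃ i, K i)ᶜ * Real.log (Fintype.card ι / η) ≤ γ := by
    refine (mul_le_mul_of_nonneg_right hU hlog.le).trans (le_of_eq ?_)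
    rw [hθ]; field_simp
  refine (iInf₂_le n hn1).trans (EReal.coe_le_coe_iff.2 ?_)
  rw [div_lt_iff₀ hn0] at hn
  rw [div_le_iff₀ hn0]
  have h3 : (n : ℝ) * (-Real.log (1 - η) +
      μ.real (⋃ i, K i)ᶜ * Real.log (Fintype.card ι / η)) ≤ n * (2 * γ) :=
    mul_le_mul_of_nonneg_left (by linarith) hn0.le
  rw [hγ] at h3
  linarith

end UpperBound

/-! ### Topological entropy is bounded by measure entropies -/

/-! ### Block decompositions and averages along orbits -/

section Tiling

variable {X : Type*} [MeasurableSpace X] {T : X → X} {ι : Type*} [Fintype ι] {P : ι → Set X}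

theorem isProbabilityMeasure_map_iterate (hT : Measurable T) (σ : Measure X)
    [IsProbabilityMeasure σ] (a : ℕ) : IsProbabilityMeasure (σ.map T^[a]) :=
  Measure.isProbabilityMeasure_map (hT.iterate a).aemeasurable

theorem IsPartition.partEntropy_refinement_le_mul_log_card (hP : IsPartition P)
    (hT : Measurable T) (σ : Measure X) [IsProbabilityMeasure σ] (n : ℕ) :
    partEntropy σ (VarPrinciple.refinement T P n) ≤ n * Real.log (Fintype.card ι) := by
  refine ((hP.refinement hT n).partEntropy_le_log_card σ).trans (le_of_eq ?_)
  simp [Real.log_pow]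

/-- Subadditivity peels off one block at a time. As `σ` need not be invariant, each block sees its
own pushforward; the free start `a` drives the induction. -/
theorem IsPartition.partEntropy_refinement_mul_add_le (hP : IsPartition P) (hT : Measurable T)
    (σ : Measure X) [IsProbabilityMeasure σ] (q b L a : ℕ) :
    partEntropy (σ.map T^[a]) (VarPrinciple.refinement T P (L * q + b)) ≤
      ∑ r ∈ Finset.range L, partEntropy (σ.map T^[a + r * q]) (VarPrinciple.refinement T P q) +
        b * Real.log (Fintype.card ι) := by
  have := isProbabilityMeasure_map_iterate hT σ
  induction L generalizing a with
  | zero =>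
    rw [zero_mul, zero_add]
    simpa using hP.partEntropy_refinement_le_mul_log_card hT (σ.map T^[a]) b
  | succ L ih =>
    rw [show (L + 1) * q + b = q + (L * q + b) by ring, Finset.sum_range_succ']
    have h1 := hP.partEntropy_refinement_add_le hT (σ.map T^[a]) q (L * q + b)
    rw [Measure.map_map (hT.iterate q) (hT.iterate a), ← Function.iterate_add, add_comm q a] at h1
    have h2 := ih (a + q)
    have h3 : ∀ r, a + q + r * q = a + (r + 1) * q := fun r => by ring
    simp only [h3] at h2
    simp only [zero_mul, add_zero]
    linarith

theorem sum_range_mul_eq_sum_sum {M : Type*} [AddCommMonoid M] (h : ℕ → M) (q L : ℕ) :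
    ∑ m ∈ Finset.range (L * q), h m =
      ∑ j ∈ Finset.range q, ∑ r ∈ Finset.range L, h (j + r * q) := by
  induction L with
  | zero => simp
  | succ L ih =>
    rw [add_mul, one_mul, Finset.sum_range_add, ih]
    simp only [Finset.sum_range_succ, Finset.sum_add_distrib, add_comm (L * q)]

/-- Tile `[0, n)` by `q`-blocks with each offset `j < q`. Over all offsets the blocks start once at
each time below `L * q`, and each offset leaves at most `2 * q` times uncovered. -/
theorem IsPartition.mul_partEntropy_refinement_le (hP : IsPartition P) (hT : Measurable T)
    (σ : Measure X) [IsProbabilityMeasure σ] {q n : ℕ} (hq : 1 ≤ q) (hqn : q ≤ n) :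
    q * partEntropy σ (VarPrinciple.refinement T P n) ≤
      ∑ m ∈ Finset.range n, partEntropy (σ.map T^[m]) (VarPrinciple.refinement T P q) +
        2 * q ^ 2 * Real.log (Fintype.card ι) := by
  have := isProbabilityMeasure_map_iterate hT σ
  have hlog : 0 ≤ Real.log (Fintype.card ι) := Real.log_natCast_nonneg _
  -- One block fewer than fits, so that every offset leaves room for `L` blocks.
  obtain ⟨L, hL⟩ : ∃ L, n / q = L + 1 :=
    ⟨n / q - 1, (Nat.sub_add_cancel (Nat.div_pos hqn hq)).symm⟩
  have hn1 : (L + 1) * q ≤ n := hL ▸ Nat.div_mul_le_self n q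
  have hn2 : n < (L + 2) * q := by
    have := Nat.lt_div_mul_add hq (a := n)
    rw [hL] at this
    linarith
  have hj : ∀ j ∈ Finset.range q, partEntropy σ (VarPrinciple.refinement T P n) ≤
      ∑ r ∈ Finset.range L, partEntropy (σ.map T^[j + r * q]) (VarPrinciple.refinement T P q) +
        2 * q * Real.log (Fintype.card ι) := by
    intro j hj
    have hj := Finset.mem_range.1 hj
    obtain ⟨b, hb⟩ : ∃ b, n = j + (L * q + b) := Nat.exists_eq_add_of_le
      (show j + L * q ≤ n by linarith) |>.imp fun b hb => by omega
    have hjb : ((j + b : ℕ) : ℝ) ≤ 2 * q := by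
      have : j + b ≤ 2 * q := by linarith
      exact_mod_cast this
    have h1 := hP.partEntropy_refinement_add_le hT σ j (L * q + b)
    rw [← hb] at h1
    have h2 := hP.partEntropy_refinement_le_mul_log_card hT σ j
    have h3 := hP.partEntropy_refinement_mul_add_le hT σ q b L j
    have h4 := mul_le_mul_of_nonneg_right hjb hlog
    push_cast at h4
    linarith
  have hsum := Finset.sum_le_sum hj
  rw [Finset.sum_const, Finset.card_range, nsmul_eq_mul, Finset.sum_add_distrib,
    Finset.sum_const, Finset.card_range, nsmul_eq_mul, ← sum_range_mul_eq_sum_sum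
      (fun m => partEntropy (σ.map T^[m]) (VarPrinciple.refinement T P q))] at hsum
  have hmono : ∑ m ∈ Finset.range (L * q),
      partEntropy (σ.map T^[m]) (VarPrinciple.refinement T P q) ≤
      ∑ m ∈ Finset.range n, partEntropy (σ.map T^[m]) (VarPrinciple.refinement T P q) :=
    Finset.sum_le_sum_of_subset_of_nonneg (Finset.range_mono (by linarith))
      fun _ _ _ => partEntropy_nonneg _ _
  linarith

/-- The average `(1 / n) ∑ m < n, T^m_* σ` of a measure along its orbit. -/
noncomputable def orbitAverage (T : X → X) (n : ℕ) (σ : Measure X) : Measure X :=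
  (n : ENNReal)⁻¹ • ∑ m ∈ Finset.range n, σ.map T^[m]

theorem isProbabilityMeasure_orbitAverage (hT : Measurable T) {n : ℕ} (hn : 1 ≤ n)
    (σ : Measure X) [IsProbabilityMeasure σ] : IsProbabilityMeasure (orbitAverage T n σ) := by
  have := isProbabilityMeasure_map_iterate hT σ
  constructor
  have hn0 : (n : ENNReal) ≠ 0 := by exact_mod_cast (by omega : n ≠ 0)
  simp [orbitAverage, ENNReal.inv_mul_cancel hn0]

theorem orbitAverage_real (hT : Measurable T) (n : ℕ) (σ : Measure X) [IsProbabilityMeasure σ]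
    (A : Set X) : (orbitAverage T n σ).real A =
      ∑ m ∈ Finset.range n, (n : ℝ)⁻¹ * (σ.map T^[m]).real A := by
  have := isProbabilityMeasure_map_iterate hT σ
  rw [← Finset.mul_sum]
  simp only [orbitAverage, measureReal_def, Measure.smul_apply, Measure.finsetSum_apply,
    smul_eq_mul, ENNReal.toReal_mul, ENNReal.toReal_inv, ENNReal.toReal_natCast]
  rw [ENNReal.toReal_sum fun m _ => measure_ne_top _ _]

/-- Jensen's inequality for the concave `Real.negMulLog`, cell by cell. -/
theorem sum_partEntropy_map_le (hT : Measurable T) (n : ℕ) (σ : Measure X)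
    [IsProbabilityMeasure σ] (P : ι → Set X) :
    ∑ m ∈ Finset.range n, partEntropy (σ.map T^[m]) P ≤
      n * partEntropy (orbitAverage T n σ) P := by
  rcases Nat.eq_zero_or_pos n with rfl | hn
  · simp
  have hn' : (0 : ℝ) < n := by exact_mod_cast hn
  simp only [partEntropy_eq_sum_negMulLog]
  rw [Finset.sum_comm, Finset.mul_sum]
  refine Finset.sum_le_sum fun i _ => ?_
  have h := Real.concaveOn_negMulLog.le_map_sum (t := Finset.range n) (w := fun _ => (n : ℝ)⁻¹)
    (p := fun m => (σ.map T^[m]).real (P i)) (fun _ _ => by positivity)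
    (by simp [hn'.ne']) (fun _ _ => measureReal_nonneg)
  simp only [smul_eq_mul] at h
  rw [← orbitAverage_real hT, ← Finset.mul_sum, inv_mul_le_iff₀ hn'] at h
  exact h

end Tiling

/-! ### Uniform measures on separated sets -/

section Uniform

variable {X : Type*} [MeasurableSpace X]

/-- The uniform probability measure on a nonempty finite set. -/
noncomputable def uniformMeasure (E : Finset X) : Measure X :=
  (E.card : ENNReal)⁻¹ • ∑ x ∈ E, Measure.dirac x

theorem isProbabilityMeasure_uniformMeasure {E : Finset X} (hE : E.Nonempty) :
    IsProbabilityMeasure (uniformMeasure E) := by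
  constructor
  have : (E.card : ENNReal) ≠ 0 := by exact_mod_cast hE.card_ne_zero
  simp [uniformMeasure, ENNReal.inv_mul_cancel this]

/-- A cell holds at most one point of `E`, so its mass is `0` or `1 / |E|`. -/
theorem IsPartition.log_card_le_partEntropy {ι : Type*} [Fintype ι] {P : ι → Set X}
    (hP : IsPartition P) {E : Finset X} (hE : E.Nonempty)
    (hEP : ∀ i, ∀ x ∈ E, ∀ y ∈ E, x ∈ P i → y ∈ P i → x = y) :
    Real.log E.card ≤ partEntropy (uniformMeasure E) P := by
  classical
  have := isProbabilityMeasure_uniformMeasure hE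
  have hval : ∀ i, (uniformMeasure E).real (P i) = 0 ∨
      (uniformMeasure E).real (P i) = (E.card : ℝ)⁻¹ := by
    intro i
    have h1 : (uniformMeasure E).real (P i) = (E.card : ℝ)⁻¹ * (E.filter (· ∈ P i)).card := by
      simp [uniformMeasure, measureReal_def, Measure.dirac_apply' _ (hP.measurableSet i),
        Set.indicator_apply]
    have h2 : (E.filter (· ∈ P i)).card ≤ 1 := Finset.card_le_one.2 fun x hx y hy => by
      rw [Finset.mem_filter] at hx hy
      exact hEP i x hx.1 y hy.1 hx.2 hy.2
    rw [h1]
    interval_cases (E.filter (· ∈ P i)).card <;> simp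
  have hterm : ∀ i, (uniformMeasure E).real (P i) * Real.log ((uniformMeasure E).real (P i)) =
      (uniformMeasure E).real (P i) * -Real.log E.card := fun i => by
    rcases hval i with h | h <;> simp [h]
  simp only [partEntropy, hterm]
  rw [← Finset.sum_mul, hP.sum_measureReal]
  simp

theorem log_card_le_partEntropy_refinement {X : Type*} [MetricSpace X] [MeasurableSpace X]
    {T : X → X} (hT : Measurable T) {ι : Type*} [Fintype ι] {P : ι → Set X}
    (hP : IsPartition P) {n : ℕ} {ε : ℝ} (hε : 0 ≤ ε)
    (hPε : ∀ i, ∀ x ∈ P i, ∀ y ∈ P i, dist x y ≤ ε) {E : Finset X} (hE : E.Nonempty)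
    (hEs : IsDynSeparated T n ε E) :
    Real.log E.card ≤ partEntropy (uniformMeasure E) (refinement T P n) := by
  refine (hP.refinement hT n).log_card_le_partEntropy hE fun w x hx y hy hxw hyw => ?_
  by_contra hne
  rw [mem_refinement] at hxw hyw
  exact (hEs hx hy hne).not_ge <| (dynDist_le_iff hε).2 fun k hk =>
    hPε _ _ (hxw ⟨k, hk⟩) _ (hyw ⟨k, hk⟩)

end Uniform

/-! ### Partitions with null boundaries -/

theorem frontier_iInter_subset {Y κ : Type*} [TopologicalSpace Y] [Finite κ] (s : κ → Set Y) :
    frontier (⋂ k, s k) ⊆ ⋃ k, frontier (s k) := by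
  intro x hx
  rw [frontier, interior_iInter_of_finite] at hx
  obtain ⟨k, hk⟩ := not_forall.1 (mt Set.mem_iInter.2 hx.2)
  exact Set.mem_iUnion.2 ⟨k, closure_mono (Set.iInter_subset s k) hx.1, hk⟩

section NullFrontier

variable {X : Type*} [MetricSpace X] [MeasurableSpace X] [BorelSpace X]

theorem measure_frontier_refinement_eq_zero {T : X → X} (hT : Continuous T) {μ : Measure X}
    (hμ : MeasurePreserving T μ μ) {ι : Type*} {P : ι → Set X}
    (hP : ∀ i, μ (frontier (P i)) = 0) (n : ℕ) (w : Fin n → ι) :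
    μ (frontier (refinement T P n w)) = 0 := by
  refine measure_mono_null (frontier_iInter_subset _) (measure_iUnion_null fun k => ?_)
  refine measure_mono_null ((hT.iterate k).frontier_preimage_subset _) ?_
  rw [(hμ.iterate k).measure_preimage isClosed_frontier.measurableSet.nullMeasurableSet]
  exact hP _

/-- Fine partitions whose cells have null boundary. -/
theorem exists_isPartition_null_frontier [CompactSpace X] (μ : Measure X) [IsFiniteMeasure μ]
    {ε : ℝ} (hε : 0 < ε) : ∃ (m : ℕ) (P : Fin m → Set X), IsPartition P ∧
      (∀ i, ∀ x ∈ P i, ∀ y ∈ P i, dist x y ≤ ε) ∧ ∀ i, μ (frontier (P i)) = 0 := by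
  have hr : ∀ x : X, ∃ r ∈ Set.Ioo 0 (ε / 2), μ (frontier (Metric.ball x r)) = 0 := fun x => by
    simpa using exists_null_frontier_thickening μ {x} (half_pos hε)
  choose r hr hrμ using hr
  obtain ⟨t, ht⟩ := isCompact_univ.elim_finite_subcover (fun x => Metric.ball x (r x))
    (fun _ => Metric.isOpen_ball) fun x _ => Set.mem_iUnion.2 ⟨x, Metric.mem_ball_self (hr x).1⟩
  let g : Fin t.card → Set X := fun i =>
    Metric.ball (t.equivFin.symm i : X) (r (t.equivFin.symm i))
  have hsub : ∀ i, disjointed g i ⊆ g i := fun i => disjointed_le g i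
  refine ⟨t.card, disjointed g, ⟨fun i => ?_, disjoint_disjointed g, ?_⟩, fun i x hx y hy => ?_,
    fun i => ?_⟩
  · exact disjointedRec (p := MeasurableSet) (fun s j hs => hs.diff measurableSet_ball)
      measurableSet_ball
  · rw [iUnion_disjointed, Set.eq_univ_iff_forall]
    intro x
    obtain ⟨y, hy, hxy⟩ := Set.mem_iUnion₂.1 (ht (Set.mem_univ x))
    exact Set.mem_iUnion.2 ⟨t.equivFin ⟨y, hy⟩, by simpa [g] using hxy⟩
  · have h1 := Metric.mem_ball.1 (hsub i hx)
    have h2 := Metric.mem_ball.1 (hsub i hy)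
    have h3 := (hr (t.equivFin.symm i : X)).2
    linarith [dist_triangle_right x y (t.equivFin.symm i : X)]
  · exact disjointedRec (p := fun s => μ (frontier s) = 0)
      (fun s j hs => by
      rw [Set.sdiff_eq]
      exact null_frontier_inter hs ((frontier_compl (g j)).symm ▸ hrμ _)) (hrμ _)

end NullFrontier

/-! ### Limits of orbit averages -/

section Limit

variable {X : Type*} [MetricSpace X] [MeasurableSpace X] [BorelSpace X] {T : X → X}

theorem integral_orbitAverage (hT : Continuous T) (n : ℕ) (σ : Measure X)
    [IsProbabilityMeasure σ] (f : BoundedContinuousFunction X ℝ) :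
    ∫ x, f x ∂orbitAverage T n σ = (n : ℝ)⁻¹ * ∑ m ∈ Finset.range n, ∫ x, f (T^[m] x) ∂σ := by
  have := isProbabilityMeasure_map_iterate hT.measurable σ
  rw [orbitAverage, integral_smul_measure, integral_finsetSum_measure fun m _ => f.integrable _]
  simp only [ENNReal.toReal_inv, ENNReal.toReal_natCast, smul_eq_mul]
  congr 1
  refine Finset.sum_congr rfl fun m _ => ?_
  exact integral_map (hT.iterate m).measurable.aemeasurable f.continuous.aestronglyMeasurable

/-- The difference telescopes to its two end terms; this makes limits of orbit averages invariant.
-/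
theorem abs_integral_comp_sub_integral_orbitAverage_le (hT : Continuous T) (n : ℕ)
    (σ : Measure X) [IsProbabilityMeasure σ] (f : BoundedContinuousFunction X ℝ) :
    |∫ x, f (T x) ∂orbitAverage T n σ - ∫ x, f x ∂orbitAverage T n σ| ≤
      (n : ℝ)⁻¹ * (2 * ‖f‖) := by
  have h1 := integral_orbitAverage hT n σ f
  have h2 := integral_orbitAverage hT n σ (f.compContinuous ⟨T, hT⟩)
  simp only [BoundedContinuousFunction.compContinuous_apply, ContinuousMap.coe_mk] at h2
  have hbd : ∀ m, |∫ x, f (T^[m] x) ∂σ| ≤ ‖f‖ := fun m => by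
    simpa using norm_integral_le_of_norm_le_const (μ := σ) (f := fun x => f (T^[m] x))
      (Eventually.of_forall fun x => f.norm_coe_le_norm _)
  rw [h1, h2, ← mul_sub, ← Finset.sum_sub_distrib]
  simp only [← Function.iterate_succ_apply']
  rw [Finset.sum_range_sub (fun m => ∫ x, f (T^[m] x) ∂σ), abs_mul, abs_of_nonneg (by positivity)]
  refine mul_le_mul_of_nonneg_left ?_ (by positivity)
  linarith [abs_sub (∫ x, f (T^[n] x) ∂σ) (∫ x, f (T^[0] x) ∂σ), hbd n, hbd 0]

theorem mem_invariantMeasures_of_tendsto (hT : Continuous T) {U : Filter ℕ} [U.NeBot]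
    (hU : U ≤ atTop) {σ : ℕ → Measure X} (hσ : ∀ n, IsProbabilityMeasure (σ n))
    {ν : ℕ → ProbabilityMeasure X} (hν : ∀ n, 1 ≤ n → (ν n : Measure X) = orbitAverage T n (σ n))
    {μ : ProbabilityMeasure X} (h : Tendsto ν U (𝓝 μ)) : μ ∈ invariantMeasures T := by
  have hmap : (μ : Measure X).map T = μ := by
    have : IsProbabilityMeasure ((μ : Measure X).map T) :=
      Measure.isProbabilityMeasure_map hT.measurable.aemeasurable
    refine ext_of_forall_integral_eq_of_IsFiniteMeasure fun f => ?_
    rw [integral_map hT.measurable.aemeasurable f.continuous.aestronglyMeasurable]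
    rw [ProbabilityMeasure.tendsto_iff_forall_integral_tendsto] at h
    have h1 := h f
    have h2 := h (f.compContinuous ⟨T, hT⟩)
    simp only [BoundedContinuousFunction.compContinuous_apply, ContinuousMap.coe_mk] at h2
    have h3 : Tendsto (fun n => ∫ x, f (T x) ∂(ν n : Measure X) - ∫ x, f x ∂(ν n : Measure X))
        U (𝓝 0) := by
      have h0 : Tendsto (fun n : ℕ => (n : ℝ)⁻¹ * (2 * ‖f‖)) U (𝓝 0) := by
        simpa using (tendsto_inv_atTop_nhds_zero_nat (𝕜 := ℝ)).mono_left hU |>.mul_const (2 * ‖f‖)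
      refine squeeze_zero_norm' ?_ h0
      filter_upwards [hU (eventually_ge_atTop 1)] with n hn
      rw [hν n hn]
      exact abs_integral_comp_sub_integral_orbitAverage_le hT n (σ n) f
    exact sub_eq_zero.1 (tendsto_nhds_unique (h2.sub h1) h3)
  intro A hA
  rw [← Measure.map_apply hT.measurable hA, hmap]

theorem tendsto_partEntropy {U : Filter ℕ} {ν : ℕ → ProbabilityMeasure X}
    {μ : ProbabilityMeasure X} (h : Tendsto ν U (𝓝 μ)) {ι : Type*} [Fintype ι] {P : ι → Set X}
    (hP : ∀ i, (μ : Measure X) (frontier (P i)) = 0) :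
    Tendsto (fun n => partEntropy (ν n : Measure X) P) U (𝓝 (partEntropy (μ : Measure X) P)) := by
  simp only [partEntropy_eq_sum_negMulLog]
  refine tendsto_finsetSum _ fun i _ => (Real.continuous_negMulLog.tendsto _).comp ?_
  exact (ENNReal.tendsto_toReal (measure_ne_top _ _)).comp
    (ProbabilityMeasure.tendsto_measure_of_null_frontier_of_tendsto' h (hP i))

/-- For fixed `q`, tiling and concavity give `q * c ≤ H(P^q) + O(1 / n)` for the orbit average.
Invariance of `μ` keeps the boundaries of `P^q` null, so `n` can go to infinity. -/
theorem coe_le_entropyOfPartition_of_tendsto (hT : Continuous T) {U : Filter ℕ} [U.NeBot]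
    (hU : U ≤ atTop) {σ : ℕ → Measure X} (hσ : ∀ n, IsProbabilityMeasure (σ n))
    {ν : ℕ → ProbabilityMeasure X} (hν : ∀ n, 1 ≤ n → (ν n : Measure X) = orbitAverage T n (σ n))
    {μ : ProbabilityMeasure X} (h : Tendsto ν U (𝓝 μ)) {ι : Type*} [Fintype ι] {P : ι → Set X}
    (hP : IsPartition P) (hPμ : ∀ i, (μ : Measure X) (frontier (P i)) = 0) {c : ℝ}
    (hc : ∀ᶠ n in U, n * c ≤ partEntropy (σ n) (refinement T P n)) :
    (c : EReal) ≤ entropyOfPartition (μ : Measure X) T P := by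
  have hμ := measurePreserving_of_mem_invariantMeasures hT.measurable
    (mem_invariantMeasures_of_tendsto hT hU hσ hν h)
  refine le_iInf₂ fun q hq => EReal.coe_le_coe_iff.2 ?_
  have hq0 : (0 : ℝ) < q := by exact_mod_cast hq
  rw [le_div_iff₀ hq0]
  have hlim := tendsto_partEntropy h (measure_frontier_refinement_eq_zero hT hμ hPμ q)
  have h0 : Tendsto (fun n : ℕ => (n : ℝ)⁻¹ * (2 * q ^ 2 * Real.log (Fintype.card ι))) U
      (𝓝 0) := by
    simpa using (tendsto_inv_atTop_nhds_zero_nat (𝕜 := ℝ)).mono_left hU |>.mul_const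
      (2 * q ^ 2 * Real.log (Fintype.card ι))
  have hlim' := hlim.add h0
  rw [add_zero] at hlim'
  refine ge_of_tendsto hlim' ?_
  filter_upwards [hc, hU (eventually_ge_atTop q)] with n hn hqn
  have hn0 : (0 : ℝ) < n := by exact_mod_cast hq.trans hqn
  have h1 := hP.mul_partEntropy_refinement_le hT.measurable (σ n) hq hqn
  have h2 := sum_partEntropy_map_le hT.measurable n (σ n) (refinement T P q)
  rw [← hν n (hq.trans hqn)] at h2
  have h3 := mul_le_mul_of_nonneg_left hn hq0.le
  rw [← sub_le_iff_le_add', ← sub_nonneg, ← mul_nonneg_iff_of_pos_left hn0]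
  have h4 : (n : ℝ) * ((n : ℝ)⁻¹ * (2 * q ^ 2 * Real.log (Fintype.card ι))) =
      2 * q ^ 2 * Real.log (Fintype.card ι) := mul_inv_cancel_left₀ hn0.ne' _
  nlinarith

theorem exists_invariantMeasure_coe_le_measureEntropy [CompactSpace X] (hT : Continuous T)
    {ε : ℝ} (hε : 0 < ε) {c : ℝ} (hc : (c : EReal) < sepGrowth T ε) :
    ∃ μ ∈ invariantMeasures T, (c : EReal) ≤ measureEntropy (μ : Measure X) T := by
  choose E hEs hEc hE using fun n => exists_maximal_isDynSeparated hT n hε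
  have hfreq : ∃ᶠ n in atTop, n ∈ {n : ℕ | 1 ≤ n ∧ (c : EReal) <
      ENNReal.log (sepNumber T n ε : ENNReal) / (n : EReal)} :=
    ((frequently_lt_of_lt_limsup (by isBoundedDefault) hc).and_eventually
      (eventually_ge_atTop 1)).mono fun n hn => hn.symm
  -- On the empty space all growth rates with `n ≥ 1` are `⊥`, which cannot exceed `c`.
  have hX : Nonempty X := by
    by_contra hX
    rw [not_nonempty_iff] at hX
    obtain ⟨n, hn1, hn⟩ := hfreq.exists
    have : sepNumber T n ε = 0 := by rw [hEc, Finset.eq_empty_of_isEmpty (E n)]; simp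
    rw [this, ENat.toENNReal_zero, ENNReal.log_zero,
      EReal.bot_div_of_pos_ne_top (by exact_mod_cast hn1) (EReal.natCast_ne_top n)] at hn
    exact not_lt_bot hn
  have hEne : ∀ n, (E n).Nonempty := fun n => ⟨_, (hE n hX.some).choose_spec.1⟩
  have hσ := fun n => isProbabilityMeasure_uniformMeasure (hEne n)
  have hν : ∀ n, ∃ ν : ProbabilityMeasure X, 1 ≤ n →
      (ν : Measure X) = orbitAverage T n (uniformMeasure (E n)) := by
    intro n
    by_cases hn : 1 ≤ n
    · exact ⟨⟨_, isProbabilityMeasure_orbitAverage hT.measurable hn _⟩, fun _ => rfl⟩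
    -- Filler: the orbit average for `n = 0` is the zero measure.
    · exact ⟨⟨_, hσ n⟩, fun h => absurd h hn⟩
  choose ν hν using hν
  have hne := frequently_mem_iff_neBot.1 hfreq
  -- An ultrafilter on the times with rate above `c` plays the role of a convergent subsequence.
  let U := Ultrafilter.of (atTop ⊓ 𝓟 {n : ℕ | 1 ≤ n ∧ (c : EReal) <
      ENNReal.log (sepNumber T n ε : ENNReal) / (n : EReal)})
  have hU := Ultrafilter.of_le (atTop ⊓ 𝓟 {n : ℕ | 1 ≤ n ∧ (c : EReal) <
      ENNReal.log (sepNumber T n ε : ENNReal) / (n : EReal)})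
  have hU1 : (U : Filter ℕ) ≤ atTop := hU.trans inf_le_left
  have hU2 := (hU.trans inf_le_right) (mem_principal_self _)
  obtain ⟨μ, -, hμ⟩ := isCompact_univ.ultrafilter_le_nhds' (U.map ν) univ_mem
  have hμ : Tendsto ν U (𝓝 μ) := hμ
  -- The partition is chosen after `μ`, whose null sets decide which boundaries are allowed.
  obtain ⟨m, P, hP, hPε, hPμ⟩ := exists_isPartition_null_frontier (μ : Measure X) hε
  refine ⟨μ, mem_invariantMeasures_of_tendsto hT hU1 hσ hν hμ, le_iSup_of_le m <|
    le_iSup₂_of_le P hP <| coe_le_entropyOfPartition_of_tendsto hT hU1 hσ hν hμ hP hPμ ?_⟩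
  filter_upwards [hU2] with n hn
  obtain ⟨hn1, hn⟩ := hn
  rw [log_sepNumber_div (hEne n).card_pos (hEc n), EReal.coe_lt_coe_iff,
    lt_div_iff₀ (by exact_mod_cast hn1)] at hn
  have := log_card_le_partEntropy_refinement hT.measurable hP hε.le hPε (hEne n) (hEs n)
  linarith

end Limit

end VarPrinciple

theorem mainTheorem5 {X : Type*} [MetricSpace X] [CompactSpace X]
    [MeasurableSpace X] [BorelSpace X] (T : X → X) (hT : Continuous T) :
    VarPrinciple.topEntropy T =
      ⨆ μ ∈ VarPrinciple.invariantMeasures T,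
        VarPrinciple.measureEntropy (μ : MeasureTheory.Measure X) T := by
  refine le_antisymm ?_ ?_
  · rw [VarPrinciple.topEntropy_eq_iSup]
    refine iSup₂_le fun ε hε => EReal.ge_of_forall_gt_iff_ge.1 fun c hc => ?_
    obtain ⟨μ, hμ, h⟩ := VarPrinciple.exists_invariantMeasure_coe_le_measureEntropy hT hε hc
    exact le_iSup₂_of_le μ hμ h
  · exact iSup₂_le fun μ hμ => iSup_le fun m => iSup₂_le fun P hP =>
      hP.entropyOfPartition_le_topEntropy hT
        (VarPrinciple.measurePreserving_of_mem_invariantMeasures hT.measurable hμ)
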